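/- Let $\rho$ be a qubit state, i.e. a positive semidefinite $2\times 2$ complex matrix with $\operatorname{tr}\rho=1$, and let $\mathcal P=\operatorname{tr}(\rho^2)$ be its purity. For an orthonormal basis $\mathbb X=\{|x_1\rangle,|x_2\rangle\}$ of $\mathbb C^2$ let $\mathcal I_{\mathbb X}$ be the set of states of the form $\sum_i\lambda_i|x_i\rangle\langle x_i|$, and let $$C_g^{\mathbb X}(\rho)=1-\max_{\sigma\in\mathcal I_{\mathbb X}}F(\rho,\sigma),\qquad F(\rho,\sigma)=\Bigl(\operatorname{tr}\sqrt{\sqrt\rho\,\sigma\sqrt\rho}\Bigr)^2,$$ be the geometric coherence of $\rho$ with respect to $\mathbb X$. Let $\mathbb X,\mathbb Y,\mathbb Z$ be three orthonormal bases of $\mathbb C^2$, and let $\mathfrak c_1\ge\mathfrak c_2\ge\mathfrak c_3$ be the three numbers $\max_{i,j}|\langle x_i|y_j\rangle|^2$, $\max_{i,j}|\langle y_i|z_j\rangle|^2$, $\max_{i,j}|\langle x_i|z_j\rangle|^2$ arranged in descending order. Put $f(x)=\sqrt{1+4(2\mathcal P-1)(x^2-x)}$. (1) If $1+\sqrt{\mathfrak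 c_3}<\sqrt{\mathfrak c_1}+\sqrt{\mathfrak c_2}$, then $$C_g^{\mathbb X}(\rho)+C_g^{\mathbb Y}(\rho)+C_g^{\mathbb Z}(\rho)\ \ge\ 1-\tfrac12\bigl[f(\sqrt{\mathfrak c_1})+f(\sqrt{\mathfrak c_1}-\sqrt{\mathfrak c_3})\bigr].$$ (2) If $1+\sqrt{\mathfrak c_3}\ge\sqrt{\mathfrak c_1}+\sqrt{\mathfrak c_2}$, then $$C_g^{\mathbb X}(\rho)+C_g^{\mathbb Y}(\rho)+C_g^{\mathbb Z}(\rho)\ \ge\ \tfrac32-\tfrac12\max\Bigl\{1+f(\sqrt{\mathfrak c_1})+f(\sqrt{\mathfrak c_2}),\ f\bigl(\tfrac{1-\sqrt{\mathfrak c_1}-\sqrt{\mathfrak c_2}+\sqrt{\mathfrak c_3}}2\bigr)+f\bigl(\tfrac{1-\sqrt{\mathfrak c_1}+\sqrt{\mathfrak c_2}-\sqrt{\mathfrak c_3}}2\bigr)+f\bigl(\tfrac{1+\sqrt{\mathfrak c_1}-\sqrt{\mathfrak c_2}-\sqrt{\mathfrak c_3}}2\bigr)\Bigr\}.$$ -/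

import Mathlib

namespace GeomCoherence

open scoped ComplexOrder

noncomputable section

variable {d : ℕ}

/-- The `d`-dimensional Hilbert space. -/
abbrev Hilb (d : ℕ) : Type := EuclideanSpace ℂ (Fin d)

/-- A quantum state: a positive semidefinite matrix of trace one. -/
def IsState (ρ : Matrix (Fin d) (Fin d) ℂ) : Prop :=
  ρ.PosSemidef ∧ ρ.trace = 1

/-- The purity `tr (ρ ^ 2)`. -/
def purity (ρ : Matrix (Fin d) (Fin d) ℂ) : ℝ :=
  (ρ * ρ).trace.re

/-- The rank-one operator `|v⟩⟨v|`. -/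
def ketBra (v : Hilb d) : Matrix (Fin d) (Fin d) ℂ :=
  Matrix.of fun i j => v i * star (v j)

/-- The incoherent states of the orthonormal basis `X`: the quantum states of the form
`∑ i, l i |x i⟩⟨x i|`. -/
def incoherentStates (X : OrthonormalBasis (Fin d) ℂ (Hilb d)) :
    Set (Matrix (Fin d) (Fin d) ℂ) :=
  {σ | IsState σ ∧ ∃ l : Fin d → ℝ, σ = ∑ i, (l i : ℂ) • ketBra (X i)}

/-- The square root of a positive semidefinite matrix, through the functional calculus of
Hermitian matrices. -/
def msqrt (A : Matrix (Fin d) (Fin d) ℂ) : Matrix (Fin d) (Fin d) ℂ :=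
  cfc Real.sqrt A

/-- The fidelity `(tr √(√ρ σ √ρ)) ^ 2`. -/
def fidelity (ρ σ : Matrix (Fin d) (Fin d) ℂ) : ℝ :=
  (msqrt (msqrt ρ * σ * msqrt ρ)).trace.re ^ 2

/-- The geometric coherence `1 - max F(ρ, σ)`, with `σ` running over the incoherent states
of `X`. -/
def geomCoherence (X : OrthonormalBasis (Fin d) ℂ (Hilb d))
    (ρ : Matrix (Fin d) (Fin d) ℂ) : ℝ :=
  1 - sSup (fidelity ρ '' incoherentStates X)

/-- The incompatibility `max |⟨x i | y j⟩| ^ 2` of two orthonormal bases. -/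
def incompatibility (X Y : OrthonormalBasis (Fin d) ℂ (Hilb d)) : ℝ :=
  ⨆ p : Fin d × Fin d, ‖inner ℂ (X p.1) (Y p.2)‖ ^ 2

/-- The entries of a triple of real numbers rearranged in descending order
(`Tuple.sort` sorts in ascending order, `Fin.rev` reverses). -/
def sortDesc (v : Fin 3 → ℝ) : Fin 3 → ℝ :=
  fun i => v (Tuple.sort v (Fin.rev i))

/-- The incompatibility vector of three orthonormal bases, in descending order. -/
def incompatibilityVector (X Y Z : OrthonormalBasis (Fin d) ℂ (Hilb d)) : Fin 3 → ℝ :=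
  sortDesc ![incompatibility X Y, incompatibility Y Z, incompatibility X Z]

/-- The function `f(x) = √(1 + 4 (2P - 1) (x² - x))`. -/
def fP (P x : ℝ) : ℝ :=
  √(1 + 4 * (2 * P - 1) * (x ^ 2 - x))

end

end GeomCoherence

/-!
In the Bloch representation `F(ρ, σ)` is explicit, and maximizing it over the axis of `X` (by
Cauchy–Schwarz) gives `C_g^X(ρ) ≥ (1 - f (p_X)) / 2`, where `p_X` is the larger outcome probability
when the pure state in the direction of the Bloch vector of `ρ` is measured in `X`. By the
Landau–Pollak inequality, `p_X + p_Y ≤ 1 + √c_XY`. Since `f` is convex, symmetric about `1 / 2` and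
increasing on `[1 / 2, 1]`, its sum over three points subject to these constraints is bounded by
sliding one point along its feasible segment to an end: at `1` the other two points are forced by
their constraints with it, and the other end is either the point where all three pairwise
constraints are tight or one where a second point equals `1`.
-/

namespace GeomCoherence

open Matrix Set
open scoped ComplexOrder MatrixOrder

/-! ### Square roots and fidelity of qubit matrices -/

lemma msqrt_eq_sqrt {d : ℕ} {A : Matrix (Fin d) (Fin d) ℂ} (hA : A.PosSemidef) :
    msqrt A = CFC.sqrt A := by
  rw [CFC.sqrt_eq_real_sqrt A hA.nonneg, cfcₙ_eq_cfc, msqrt]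

lemma trace_sq_fin_two {R : Type*} [CommRing R] (M : Matrix (Fin 2) (Fin 2) R) :
    M.trace ^ 2 = (M * M).trace + 2 * M.det := by
  simp only [trace_fin_two, det_fin_two, mul_apply, Fin.sum_univ_two]
  ring

lemma ofReal_re_det {n : Type*} [Fintype n] [DecidableEq n] {M : Matrix n n ℂ}
    (hM : M.PosSemidef) : (M.det.re : ℂ) = M.det :=
  (Complex.eq_re_of_ofReal_le hM.det_nonneg).symm

lemma re_trace_msqrt_sq {M : Matrix (Fin 2) (Fin 2) ℂ} (hM : M.PosSemidef) :
    (msqrt M).trace.re ^ 2 = M.trace.re + 2 * √M.det.re := by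
  have hsqrt : (CFC.sqrt M).PosSemidef := nonneg_iff_posSemidef.1 (CFC.sqrt_nonneg M)
  have htrace : ((CFC.sqrt M).trace.re : ℂ) = (CFC.sqrt M).trace :=
    (Complex.eq_re_of_ofReal_le hsqrt.trace_nonneg).symm
  have hdet : (CFC.sqrt M).det = (√M.det.re : ℂ) := by
    rw [hM.det_sqrt, RCLike.sqrt_of_nonneg hM.det_nonneg]
    rfl
  have h := trace_sq_fin_two (CFC.sqrt M)
  rw [CFC.sqrt_mul_sqrt_self M hM.nonneg, hdet, ← htrace] at h
  rw [msqrt_eq_sqrt hM]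
  simpa [← Complex.ofReal_pow] using congrArg Complex.re h

lemma fidelity_eq_re_trace_add {ρ σ : Matrix (Fin 2) (Fin 2) ℂ} (hρ : ρ.PosSemidef)
    (hσ : σ.PosSemidef) :
    fidelity ρ σ = (ρ * σ).trace.re + 2 * √(ρ.det.re * σ.det.re) := by
  set S := CFC.sqrt ρ
  have hS : S.PosSemidef := nonneg_iff_posSemidef.1 (CFC.sqrt_nonneg ρ)
  have hSS : S * S = ρ := CFC.sqrt_mul_sqrt_self ρ hρ.nonneg
  have hM : (S * σ * S).PosSemidef := by
    simpa only [hS.isHermitian.eq] using hσ.mul_mul_conjTranspose_same S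
  have htrace : (S * σ * S).trace = (ρ * σ).trace := by
    rw [trace_mul_comm, ← mul_assoc, hSS]
  have hdet : (S * σ * S).det = ρ.det * σ.det := by
    rw [← hSS, det_mul, det_mul, det_mul]
    ring
  have hdet_re : (S * σ * S).det.re = ρ.det.re * σ.det.re := by
    rw [hdet, ← ofReal_re_det hρ, ← ofReal_re_det hσ, ← Complex.ofReal_mul]
    simp only [Complex.ofReal_re]
  rw [fidelity, msqrt_eq_sqrt hρ, re_trace_msqrt_sq hM, htrace, hdet_re]

/-! ### Bloch vectors -/

/-- The Bloch vector of a `2 × 2` matrix. For Hermitian `M` its entries are the traces of the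
products of `M` with the three Pauli matrices. -/
noncomputable def bloch : Matrix (Fin 2) (Fin 2) ℂ →ₗ[ℝ] EuclideanSpace ℝ (Fin 3) where
  toFun M := !₂[2 * (M 1 0).re, 2 * (M 1 0).im, (M 0 0).re - (M 1 1).re]
  map_add' M N := by ext i; fin_cases i <;> simp <;> ring
  map_smul' a M := by ext i; fin_cases i <;> simp <;> ring

lemma two_mul_re_trace_mul {M N : Matrix (Fin 2) (Fin 2) ℂ} (hM : M.IsHermitian)
    (hN : N.IsHermitian) :
    2 * (M * N).trace.re = M.trace.re * N.trace.re + inner ℝ (bloch M) (bloch N) := by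
  have hM00 : (M 0 0).im = 0 := Complex.conj_eq_iff_im.1 (hM.apply 0 0)
  have hM11 : (M 1 1).im = 0 := Complex.conj_eq_iff_im.1 (hM.apply 1 1)
  simp [bloch, trace_fin_two, mul_apply, Fin.sum_univ_two, Fin.sum_univ_three,
    PiLp.inner_apply, ← hM.apply 0 1, ← hN.apply 0 1, hM00, hM11]
  ring

lemma four_mul_re_det {M : Matrix (Fin 2) (Fin 2) ℂ} (hM : M.IsHermitian) :
    4 * M.det.re = M.trace.re ^ 2 - ‖bloch M‖ ^ 2 := by
  have h00 : (M 0 0).im = 0 := Complex.conj_eq_iff_im.1 (hM.apply 0 0)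
  rw [EuclideanSpace.norm_sq_eq]
  simp [bloch, trace_fin_two, det_fin_two, Fin.sum_univ_three, ← hM.apply 0 1, h00]
  ring

lemma norm_bloch_sq {ρ : Matrix (Fin 2) (Fin 2) ℂ} (hρ : IsState ρ) :
    ‖bloch ρ‖ ^ 2 = 2 * purity ρ - 1 := by
  have h := two_mul_re_trace_mul hρ.1.isHermitian hρ.1.isHermitian
  rw [hρ.2, real_inner_self_eq_norm_sq, Complex.one_re] at h
  rw [purity]
  linarith

lemma four_mul_re_det_of_isState {ρ : Matrix (Fin 2) (Fin 2) ℂ} (hρ : IsState ρ) :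
    4 * ρ.det.re = 1 - ‖bloch ρ‖ ^ 2 := by
  rw [four_mul_re_det hρ.1.isHermitian, hρ.2, Complex.one_re, one_pow]

lemma norm_bloch_sq_le_one {ρ : Matrix (Fin 2) (Fin 2) ℂ} (hρ : IsState ρ) :
    ‖bloch ρ‖ ^ 2 ≤ 1 := by
  have hdet : 0 ≤ ρ.det.re := (Complex.nonneg_iff.1 hρ.1.det_nonneg).1
  linarith [four_mul_re_det_of_isState hρ]

lemma purity_mem_Icc {ρ : Matrix (Fin 2) (Fin 2) ℂ} (hρ : IsState ρ) :
    purity ρ ∈ Icc (1 / 2) 1 := by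
  constructor <;> linarith [norm_bloch_sq hρ, norm_bloch_sq_le_one hρ, sq_nonneg ‖bloch ρ‖]

lemma two_mul_fidelity {ρ σ : Matrix (Fin 2) (Fin 2) ℂ} (hρ : IsState ρ) (hσ : IsState σ) :
    2 * fidelity ρ σ =
      1 + inner ℝ (bloch ρ) (bloch σ) + √((1 - ‖bloch ρ‖ ^ 2) * (1 - ‖bloch σ‖ ^ 2)) := by
  have htrace := two_mul_re_trace_mul hρ.1.isHermitian hσ.1.isHermitian
  rw [hρ.2, hσ.2, Complex.one_re, one_mul] at htrace
  have hdet : √((1 - ‖bloch ρ‖ ^ 2) * (1 - ‖bloch σ‖ ^ 2)) = 4 * √(ρ.det.re * σ.det.re) := by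
    rw [← four_mul_re_det_of_isState hρ, ← four_mul_re_det_of_isState hσ,
      mul_mul_mul_comm, Real.sqrt_mul (by norm_num), Real.sqrt_mul_self (by norm_num)]
  rw [fidelity_eq_re_trace_add hρ.1 hσ.1, hdet]
  linarith

/-! ### Orthonormal bases as axes of the Bloch sphere -/

lemma ketBra_eq_vecMulVec {d : ℕ} (v : Hilb d) : ketBra v = vecMulVec v.ofLp (star v.ofLp) :=
  rfl

lemma isHermitian_ketBra {d : ℕ} (v : Hilb d) : (ketBra v).IsHermitian :=
  (posSemidef_vecMulVec_self_star v.ofLp).isHermitian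

lemma trace_ketBra {d : ℕ} (v : Hilb d) : (ketBra v).trace = (‖v‖ : ℂ) ^ 2 := by
  rw [ketBra_eq_vecMulVec, trace_vecMulVec, ← EuclideanSpace.inner_eq_star_dotProduct,
    inner_self_eq_norm_sq_to_K]
  rfl

lemma re_trace_ketBra_mul_ketBra {d : ℕ} (v w : Hilb d) :
    (ketBra v * ketBra w).trace.re = ‖inner ℂ v w‖ ^ 2 := by
  have h : (ketBra v * ketBra w).trace = inner ℂ v w * inner ℂ w v := by
    rw [ketBra_eq_vecMulVec, ketBra_eq_vecMulVec, vecMulVec_mul_vecMulVec, trace_vecMulVec,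
      dotProduct_smul, smul_eq_mul, dotProduct_comm, EuclideanSpace.inner_eq_star_dotProduct,
      EuclideanSpace.inner_eq_star_dotProduct]
  rw [h, ← RCLike.re_eq_complex_re, inner_mul_symm_re_eq_norm, norm_mul, norm_inner_symm w, sq]

lemma two_mul_norm_inner_sq (v w : Hilb 2) :
    2 * ‖inner ℂ v w‖ ^ 2 = ‖v‖ ^ 2 * ‖w‖ ^ 2 + inner ℝ (bloch (ketBra v)) (bloch (ketBra w)) := by
  rw [← re_trace_ketBra_mul_ketBra, two_mul_re_trace_mul (isHermitian_ketBra v)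
    (isHermitian_ketBra w), trace_ketBra, trace_ketBra]
  norm_cast

lemma norm_bloch_ketBra (v : Hilb 2) : ‖bloch (ketBra v)‖ = ‖v‖ ^ 2 := by
  have h := two_mul_norm_inner_sq v v
  rw [inner_self_eq_norm_sq_to_K, real_inner_self_eq_norm_sq, norm_pow, RCLike.norm_ofReal,
    abs_norm] at h
  exact (pow_left_inj₀ (norm_nonneg _) (sq_nonneg _) two_ne_zero).1 (by linarith)

/-- The Bloch vector of the first element of a qubit basis. The second element has the opposite
Bloch vector, so that the basis amounts to an axis of the Bloch sphere. -/
noncomputable def axis (X : OrthonormalBasis (Fin 2) ℂ (Hilb 2)) : EuclideanSpace ℝ (Fin 3) :=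
  bloch (ketBra (X 0))

lemma bloch_ketBra_zero (X : OrthonormalBasis (Fin 2) ℂ (Hilb 2)) :
    bloch (ketBra (X 0)) = axis X :=
  rfl

lemma norm_axis (X : OrthonormalBasis (Fin 2) ℂ (Hilb 2)) : ‖axis X‖ = 1 := by
  rw [axis, norm_bloch_ketBra, X.norm_eq_one, one_pow]

lemma bloch_ketBra_one (X : OrthonormalBasis (Fin 2) ℂ (Hilb 2)) :
    bloch (ketBra (X 1)) = -axis X := by
  have hnorm : ‖bloch (ketBra (X 1))‖ = 1 := by
    rw [norm_bloch_ketBra, X.norm_eq_one, one_pow]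
  have h := two_mul_norm_inner_sq (X 1) (X 0)
  rw [X.inner_eq_zero one_ne_zero, X.norm_eq_one, X.norm_eq_one, norm_zero,
    bloch_ketBra_zero] at h
  exact (inner_eq_neg_one_iff_of_norm_eq_one (𝕜 := ℝ) hnorm (norm_axis X)).1 (by linarith)

lemma incompatibility_eq (X Y : OrthonormalBasis (Fin 2) ℂ (Hilb 2)) :
    incompatibility X Y = (1 + |inner ℝ (axis X) (axis Y)|) / 2 := by
  have hterm (i j : Fin 2) : ‖inner ℂ (X i) (Y j)‖ ^ 2 =
      (1 + inner ℝ (bloch (ketBra (X i))) (bloch (ketBra (Y j)))) / 2 := by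
    have h := two_mul_norm_inner_sq (X i) (Y j)
    rw [X.norm_eq_one, Y.norm_eq_one] at h
    linarith
  have hsame : ‖inner ℂ (X 0) (Y 0)‖ ^ 2 = (1 + inner ℝ (axis X) (axis Y)) / 2 := hterm 0 0
  have hswap : ‖inner ℂ (X 0) (Y 1)‖ ^ 2 = (1 - inner ℝ (axis X) (axis Y)) / 2 := by
    rw [hterm, bloch_ketBra_one, bloch_ketBra_zero, inner_neg_right, ← sub_eq_add_neg]
  refine le_antisymm (ciSup_le fun ⟨i, j⟩ => ?_) ?_
  · rw [hterm]
    fin_cases i <;> fin_cases j <;>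
      simp only [Fin.zero_eta, Fin.mk_one, bloch_ketBra_zero, bloch_ketBra_one,
        inner_neg_left, inner_neg_right, neg_neg] <;>
      linarith [le_abs_self (inner ℝ (axis X) (axis Y)), neg_le_abs (inner ℝ (axis X) (axis Y))]
  · have hle (i j : Fin 2) : ‖inner ℂ (X i) (Y j)‖ ^ 2 ≤ incompatibility X Y :=
      le_ciSup (f := fun p : Fin 2 × Fin 2 => ‖inner ℂ (X p.1) (Y p.2)‖ ^ 2)
        (finite_range _).bddAbove (i, j)
    rcases abs_cases (inner ℝ (axis X) (axis Y)) with ⟨habs, _⟩ | ⟨habs, _⟩ <;>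
      linarith [hle 0 0, hle 0 1]

lemma incompatibility_comm (X Y : OrthonormalBasis (Fin 2) ℂ (Hilb 2)) :
    incompatibility X Y = incompatibility Y X := by
  rw [incompatibility_eq, incompatibility_eq, real_inner_comm]

lemma incompatibility_mem_Icc (X Y : OrthonormalBasis (Fin 2) ℂ (Hilb 2)) :
    incompatibility X Y ∈ Icc (1 / 2) 1 := by
  have h : |inner ℝ (axis X) (axis Y)| ≤ 1 := by
    simpa only [norm_axis, one_mul] using abs_real_inner_le_norm (axis X) (axis Y)
  rw [incompatibility_eq]
  constructor <;> linarith [abs_nonneg (inner ℝ (axis X) (axis Y))]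

/-! ### A lower bound for the geometric coherence -/

lemma two_mul_fidelity_le_of_mem_incoherentStates {ρ σ : Matrix (Fin 2) (Fin 2) ℂ}
    (hρ : IsState ρ) {X : OrthonormalBasis (Fin 2) ℂ (Hilb 2)} (hσ : σ ∈ incoherentStates X) :
    2 * fidelity ρ σ ≤ 1 + √(1 - ‖bloch ρ‖ ^ 2 + inner ℝ (bloch ρ) (axis X) ^ 2) := by
  obtain ⟨hσ, l, hl⟩ := hσ
  set s : ℝ := inner ℝ (bloch ρ) (axis X)
  set t := l 0 - l 1
  have hbloch : bloch σ = t • axis X := by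
    rw [hl, Fin.sum_univ_two, Complex.coe_smul, Complex.coe_smul, map_add, map_smul, map_smul,
      bloch_ketBra_zero, bloch_ketBra_one]
    module
  have hnorm : ‖bloch σ‖ ^ 2 = t ^ 2 := by
    rw [hbloch, norm_smul, norm_axis, mul_one, Real.norm_eq_abs, sq_abs]
  have hp : 0 ≤ 1 - ‖bloch ρ‖ ^ 2 := sub_nonneg.2 (norm_bloch_sq_le_one hρ)
  have hq : 0 ≤ 1 - t ^ 2 := sub_nonneg.2 (hnorm ▸ norm_bloch_sq_le_one hσ)
  -- Cauchy-Schwarz for the vectors `(s, √(1 - ‖bloch ρ‖²))` and the unit vector `(t, √(1 - t²))`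
  have hcs : t * s + √(1 - ‖bloch ρ‖ ^ 2) * √(1 - t ^ 2) ≤ √(1 - ‖bloch ρ‖ ^ 2 + s ^ 2) := by
    refine Real.le_sqrt_of_sq_le ?_
    nlinarith [sq_nonneg (s * √(1 - t ^ 2) - t * √(1 - ‖bloch ρ‖ ^ 2)),
      Real.sq_sqrt hp, Real.sq_sqrt hq]
  rw [two_mul_fidelity hρ hσ, hnorm, hbloch, inner_smul_right, Real.sqrt_mul hp]
  linarith

lemma le_geomCoherence {ρ : Matrix (Fin 2) (Fin 2) ℂ} (hρ : IsState ρ)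
    (X : OrthonormalBasis (Fin 2) ℂ (Hilb 2)) :
    (1 - √(1 - ‖bloch ρ‖ ^ 2 + inner ℝ (bloch ρ) (axis X) ^ 2)) / 2 ≤ geomCoherence X ρ := by
  have h : sSup (fidelity ρ '' incoherentStates X) ≤
      (1 + √(1 - ‖bloch ρ‖ ^ 2 + inner ℝ (bloch ρ) (axis X) ^ 2)) / 2 := by
    refine Real.sSup_le (forall_mem_image.2 fun σ hσ => ?_) (by positivity)
    linarith [two_mul_fidelity_le_of_mem_incoherentStates hρ hσ]
  rw [geomCoherence]
  linarith

/-! ### The Landau–Pollak inequality -/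

/-- The probability of the likelier outcome when the pure state whose Bloch vector points in the
direction of `bloch ρ` is measured in the basis `X`. It is `1 / 2` if `bloch ρ = 0`, where no such
direction exists. -/
noncomputable def maxProb (ρ : Matrix (Fin 2) (Fin 2) ℂ)
    (X : OrthonormalBasis (Fin 2) ℂ (Hilb 2)) : ℝ :=
  (1 + |inner ℝ (bloch ρ) (axis X)| / ‖bloch ρ‖) / 2

lemma maxProb_mem_Icc (ρ : Matrix (Fin 2) (Fin 2) ℂ) (X : OrthonormalBasis (Fin 2) ℂ (Hilb 2)) :
    maxProb ρ X ∈ Icc (1 / 2) 1 := by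
  have h0 : 0 ≤ |inner ℝ (bloch ρ) (axis X)| / ‖bloch ρ‖ := by positivity
  have h1 : |inner ℝ (bloch ρ) (axis X)| / ‖bloch ρ‖ ≤ 1 := by
    refine div_le_one_of_le₀ ?_ (norm_nonneg _)
    simpa only [norm_axis, mul_one] using abs_real_inner_le_norm (bloch ρ) (axis X)
  rw [maxProb]
  constructor <;> linarith

lemma abs_inner_add_abs_inner_le {E : Type*} [NormedAddCommGroup E] [InnerProductSpace ℝ E]
    (r x y : E) :
    |inner ℝ r x| + |inner ℝ r y| ≤ ‖r‖ * √(‖x‖ ^ 2 + ‖y‖ ^ 2 + 2 * |inner ℝ x y|) := by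
  have hadd : ‖x + y‖ ≤ √(‖x‖ ^ 2 + ‖y‖ ^ 2 + 2 * |inner ℝ x y|) := by
    refine Real.le_sqrt_of_sq_le ?_
    rw [norm_add_sq_real]
    linarith [le_abs_self (inner ℝ x y)]
  have hsub : ‖x - y‖ ≤ √(‖x‖ ^ 2 + ‖y‖ ^ 2 + 2 * |inner ℝ x y|) := by
    refine Real.le_sqrt_of_sq_le ?_
    rw [norm_sub_sq_real]
    linarith [neg_abs_le (inner ℝ x y)]
  have hradd := (abs_real_inner_le_norm r (x + y)).trans
    (mul_le_mul_of_nonneg_left hadd (norm_nonneg r))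
  have hrsub := (abs_real_inner_le_norm r (x - y)).trans
    (mul_le_mul_of_nonneg_left hsub (norm_nonneg r))
  rw [inner_add_right, abs_le] at hradd
  rw [inner_sub_right, abs_le] at hrsub
  rcases abs_cases (inner ℝ r x) with ⟨hx, _⟩ | ⟨hx, _⟩ <;>
    rcases abs_cases (inner ℝ r y) with ⟨hy, _⟩ | ⟨hy, _⟩ <;>
    rw [hx, hy] <;> linarith

lemma maxProb_add_maxProb_le (ρ : Matrix (Fin 2) (Fin 2) ℂ)
    (X Y : OrthonormalBasis (Fin 2) ℂ (Hilb 2)) :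
    maxProb ρ X + maxProb ρ Y ≤ 1 + √(incompatibility X Y) := by
  have hsqrt : √(‖axis X‖ ^ 2 + ‖axis Y‖ ^ 2 + 2 * |inner ℝ (axis X) (axis Y)|) =
      2 * √(incompatibility X Y) := by
    rw [norm_axis, norm_axis, incompatibility_eq, ← Real.sqrt_sq (zero_le_two (α := ℝ)),
      ← Real.sqrt_mul (sq_nonneg _), Real.sqrt_sq zero_le_two]
    congr 1
    ring
  have h : (|inner ℝ (bloch ρ) (axis X)| + |inner ℝ (bloch ρ) (axis Y)|) / ‖bloch ρ‖ ≤
      2 * √(incompatibility X Y) := by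
    refine div_le_of_le_mul₀ (norm_nonneg _) (by positivity) ?_
    rw [mul_comm, ← hsqrt]
    exact abs_inner_add_abs_inner_le _ _ _
  rw [add_div] at h
  rw [maxProb, maxProb]
  linarith

/-! ### The function `fP` -/

lemma fP_one (P : ℝ) : fP P 1 = 1 := by simp [fP]

lemma fP_one_sub (P x : ℝ) : fP P (1 - x) = fP P x := by
  rw [fP, fP]
  ring_nf

lemma fP_eq_sqrt_add_sq (P x : ℝ) :
    fP P x = √(1 - (2 * P - 1) + (2 * P - 1) * (2 * x - 1) ^ 2) := by
  rw [fP]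
  ring_nf

lemma monotoneOn_fP {P : ℝ} (hP : 1 / 2 ≤ P) : MonotoneOn (fP P) (Ici (1 / 2)) := by
  intro x (hx : 1 / 2 ≤ x) y _ hxy
  have hq : 0 ≤ 2 * P - 1 := by linarith
  have hx' : 0 ≤ 2 * x - 1 := by linarith
  rw [fP_eq_sqrt_add_sq, fP_eq_sqrt_add_sq]
  gcongr

-- `fP P x` is the norm of a complex number that depends affinely on `x`.
lemma convexOn_fP {P : ℝ} (hP : P ∈ Icc (1 / 2) 1) : ConvexOn ℝ univ (fP P) := by
  have hp : 0 ≤ 1 - (2 * P - 1) := by linarith [hP.2]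
  have hq : 0 ≤ 2 * P - 1 := by linarith [hP.1]
  set a : ℂ := √(1 - (2 * P - 1)) - √(2 * P - 1) * Complex.I
  set b : ℂ := √(1 - (2 * P - 1)) + √(2 * P - 1) * Complex.I
  have hline (x : ℝ) : AffineMap.lineMap a b x =
      (√(1 - (2 * P - 1)) + (√(2 * P - 1) * (2 * x - 1) : ℝ) * Complex.I : ℂ) := by
    rw [AffineMap.lineMap_apply_module', Complex.real_smul]
    push_cast
    ring
  have hnorm : fP P = norm ∘ AffineMap.lineMap (k := ℝ) a b := by
    ext x
    rw [Function.comp_apply, hline, Complex.norm_add_mul_I, mul_pow, Real.sq_sqrt hp,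
      Real.sq_sqrt hq, fP_eq_sqrt_add_sq]
  rw [hnorm]
  exact convexOn_univ_norm.comp_affineMap _

lemma le_geomCoherence_maxProb {ρ : Matrix (Fin 2) (Fin 2) ℂ} (hρ : IsState ρ)
    (X : OrthonormalBasis (Fin 2) ℂ (Hilb 2)) :
    (1 - fP (purity ρ) (maxProb ρ X)) / 2 ≤ geomCoherence X ρ := by
  have h : ‖bloch ρ‖ ^ 2 * (2 * maxProb ρ X - 1) ^ 2 = inner ℝ (bloch ρ) (axis X) ^ 2 := by
    rw [maxProb, mul_div_cancel₀ _ two_ne_zero, add_sub_cancel_left, ← mul_pow,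
      mul_comm, div_mul_cancel_of_imp, sq_abs]
    intro h
    rw [norm_eq_zero.1 h, inner_zero_left, abs_zero]
  rw [fP_eq_sqrt_add_sq, ← norm_bloch_sq hρ, h]
  exact le_geomCoherence hρ X

/-! ### Maximizing a convex function under pairwise constraints -/

section PairwiseConstraints

variable {g : ℝ → ℝ} {l u a b c A B C : ℝ}

lemma convexOn_comp_const_sub (hg : ConvexOn ℝ univ g) (m : ℝ) :
    ConvexOn ℝ univ fun t => g (m - t) :=
  hg.comp_affineMap (AffineMap.const ℝ ℝ m - AffineMap.id ℝ ℝ)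

lemma add_sub_le_of_convexOn (hg : ConvexOn ℝ univ g) {m s : ℝ} (hsa : m - s ≤ a)
    (has : a ≤ s) : g a + g (m - a) ≤ g s + g (m - s) := by
  have h := (hg.add (convexOn_comp_const_sub hg m)).le_max_of_mem_Icc
    (mem_univ (m - s)) (mem_univ s) ⟨hsa, has⟩
  simpa only [Pi.add_apply, sub_sub_cancel, add_comm (g (m - s)), max_self] using h

-- Raise `b` and `c` to `A - a` and `C - a`; the sum is then convex in `a ∈ [s, u]`.
lemma add_add_le_max_endpoints (hg : ConvexOn ℝ univ g) (hm : MonotoneOn g (Ici l)) {s : ℝ}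
    (hb : l ≤ b) (hc : l ≤ c) (hsa : s ≤ a) (hau : a ≤ u) (hab : a + b ≤ A) (hac : a + c ≤ C) :
    g a + g b + g c ≤ max (g s + g (A - s) + g (C - s)) (g u + g (A - u) + g (C - u)) := by
  have hgb : g b ≤ g (A - a) := hm hb (hb.trans (by linarith)) (by linarith)
  have hgc : g c ≤ g (C - a) := hm hc (hc.trans (by linarith)) (by linarith)
  refine (add_le_add (add_le_add_right hgb _) hgc).trans ?_
  exact ((hg.add (convexOn_comp_const_sub hg A)).add
    (convexOn_comp_const_sub hg C)).le_max_of_mem_Icc (mem_univ s) (mem_univ u) ⟨hsa, hau⟩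

lemma add_le_of_convexOn_of_le (hg : ConvexOn ℝ univ g) (hm : MonotoneOn g (Ici l)) {s : ℝ}
    (hb : l ≤ b) (hc : l ≤ c) (hbs : b ≤ s) (hcs : c ≤ s) (hbc : b + c ≤ B) :
    g b + g c ≤ g s + g (B - s) := by
  rcases le_total (B - s) b with hsb | hbs'
  · have hgc : g c ≤ g (B - b) := hm hc (hc.trans (by linarith)) (by linarith)
    linarith [add_sub_le_of_convexOn hg hsb hbs]
  · have hgb : g b ≤ g (B - s) := hm hb (hb.trans hbs') hbs'
    have hgc : g c ≤ g s := hm hc (hc.trans hcs) hcs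
    linarith

lemma add_add_le_of_add_le (hg : ConvexOn ℝ univ g) (hm : MonotoneOn g (Ici l))
    (ha : a ∈ Icc l u) (hb : b ∈ Icc l u) (hc : c ∈ Icc l u)
    (hab : a + b ≤ A) (hac : a + c ≤ A) (hbc : b + c ≤ B) (hAu : A ≤ 2 * u) (hlB : l ≤ B - u) :
    g a + g b + g c ≤ g u + g (A - u) + g (B - A + u) := by
  wlog hcb : c ≤ b generalizing b c
  · linarith [this hc hb hac hab (by linarith) (by linarith)]
  rcases le_total (A - u) b with hb' | hb'
  · have h := add_add_le_max_endpoints hg hm ha.1 hc.1 hb' hb.2 (by linarith : b + a ≤ A) hbc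
    rw [sub_sub_cancel, sub_sub_eq_add_sub, add_sub_right_comm] at h
    have hB : g (B - u) ≤ g (B - A + u) := hm hlB (hlB.trans (by linarith)) (by linarith)
    linarith [h.trans (max_le (by linarith) (by linarith) :
      _ ≤ g u + g (A - u) + g (B - A + u))]
  · have hga : g a ≤ g u := hm ha.1 (ha.1.trans ha.2) ha.2
    have h := add_le_of_convexOn_of_le hg hm hb.1 hc.1 hb' (hcb.trans hb') hbc
    rw [sub_sub_eq_add_sub, add_sub_right_comm] at h
    linarith

lemma add_add_le_max_of_add_le (hg : ConvexOn ℝ univ g) (hm : MonotoneOn g (Ici l))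
    (ha : a ∈ Icc l u) (hb : b ∈ Icc l u) (hc : c ∈ Icc l u)
    (hab : a + b ≤ A) (hac : a + c ≤ C) (hbc : b + c ≤ B)
    (hBC : B ≤ C) (hCA : C ≤ A) (hlB : l ≤ B - u) :
    g a + g b + g c ≤ max (g u + g (A - u) + g (C - u))
      (g ((A + C - B) / 2) + g ((A + B - C) / 2) + g ((B + C - A) / 2)) := by
  have hgBC : g (B - u) ≤ g (C - u) := hm hlB (hlB.trans (by linarith)) (by linarith)
  have hgCA : g (C - u) ≤ g (A - u) :=
    hm (hlB.trans (by linarith)) (hlB.trans (by linarith)) (by linarith)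
  by_cases ha' : (A + C - B) / 2 ≤ a
  · have h := add_add_le_max_endpoints hg hm hb.1 hc.1 ha' ha.2 hab hac
    rwa [show A - (A + C - B) / 2 = (A + B - C) / 2 by ring,
      show C - (A + C - B) / 2 = (B + C - A) / 2 by ring, max_comm] at h
  by_cases hb' : (A + B - C) / 2 ≤ b
  · have h := add_add_le_max_endpoints hg hm ha.1 hc.1 hb' hb.2 (by linarith : b + a ≤ A) hbc
    rw [show A - (A + B - C) / 2 = (A + C - B) / 2 by ring,
      show B - (A + B - C) / 2 = (B + C - A) / 2 by ring, max_comm] at h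
    rw [add_comm (g a)]
    refine h.trans (max_le_max ?_ ?_) <;> linarith
  by_cases hc' : (B + C - A) / 2 ≤ c
  · have h := add_add_le_max_endpoints hg hm ha.1 hb.1 hc' hc.2 (by linarith : c + a ≤ C)
      (by linarith : c + b ≤ B)
    rw [show C - (B + C - A) / 2 = (A + C - B) / 2 by ring,
      show B - (B + C - A) / 2 = (A + B - C) / 2 by ring, max_comm] at h
    rw [add_comm, ← add_assoc]
    refine h.trans (max_le_max ?_ ?_) <;> linarith
  push Not at ha' hb' hc'
  refine le_max_of_le_right (add_le_add (add_le_add ?_ ?_) ?_)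
  · exact hm ha.1 (ha.1.trans ha'.le) ha'.le
  · exact hm hb.1 (hb.1.trans hb'.le) hb'.le
  · exact hm hc.1 (hc.1.trans hc'.le) hc'.le

end PairwiseConstraints

/-! ### Coherence bounds for sorted incompatibilities -/

section Sorted

variable {ρ : Matrix (Fin 2) (Fin 2) ℂ} {X Y Z : OrthonormalBasis (Fin 2) ℂ (Hilb 2)}

lemma half_le_sqrt_incompatibility (X Y : OrthonormalBasis (Fin 2) ℂ (Hilb 2)) :
    1 / 2 ≤ √(incompatibility X Y) :=
  Real.le_sqrt_of_sq_le (by linarith [(incompatibility_mem_Icc X Y).1])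

lemma sub_fP_le_geomCoherence_add (hρ : IsState ρ)
    (hXZ : incompatibility X Z ≤ incompatibility X Y) :
    1 - 1 / 2 * (fP (purity ρ) (√(incompatibility X Y)) +
        fP (purity ρ) (√(incompatibility X Y) - √(incompatibility Y Z))) ≤
      geomCoherence X ρ + geomCoherence Y ρ + geomCoherence Z ρ := by
  have hP := purity_mem_Icc hρ
  have hsqrt := Real.sqrt_le_sqrt hXZ
  have hXY : √(incompatibility X Y) ≤ 1 := Real.sqrt_le_one.2 (incompatibility_mem_Icc X Y).2
  have h := add_add_le_of_add_le (convexOn_fP hP) (monotoneOn_fP hP.1)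
    (maxProb_mem_Icc ρ X) (maxProb_mem_Icc ρ Y) (maxProb_mem_Icc ρ Z)
    (maxProb_add_maxProb_le ρ X Y)
    ((maxProb_add_maxProb_le ρ X Z).trans (by linarith))
    (maxProb_add_maxProb_le ρ Y Z) (by linarith)
    (by linarith [half_le_sqrt_incompatibility Y Z])
  rw [fP_one, add_sub_cancel_left, add_sub_add_left_eq_sub,
    show √(incompatibility Y Z) - √(incompatibility X Y) + 1 =
      1 - (√(incompatibility X Y) - √(incompatibility Y Z)) by ring, fP_one_sub] at h
  linarith [le_geomCoherence_maxProb hρ X, le_geomCoherence_maxProb hρ Y,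
    le_geomCoherence_maxProb hρ Z]

lemma sub_max_fP_le_geomCoherence_add (hρ : IsState ρ)
    (hYZ : incompatibility Y Z ≤ incompatibility X Z)
    (hXZ : incompatibility X Z ≤ incompatibility X Y) :
    3 / 2 - 1 / 2 * max
        (1 + fP (purity ρ) (√(incompatibility X Y)) + fP (purity ρ) (√(incompatibility X Z)))
        (fP (purity ρ) ((1 - √(incompatibility X Y) - √(incompatibility X Z)
            + √(incompatibility Y Z)) / 2)
          + fP (purity ρ) ((1 - √(incompatibility X Y) + √(incompatibility X Z)
            - √(incompatibility Y Z)) / 2)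
          + fP (purity ρ) ((1 + √(incompatibility X Y) - √(incompatibility X Z)
            - √(incompatibility Y Z)) / 2)) ≤
      geomCoherence X ρ + geomCoherence Y ρ + geomCoherence Z ρ := by
  have hP := purity_mem_Icc hρ
  have h := add_add_le_max_of_add_le (convexOn_fP hP) (monotoneOn_fP hP.1)
    (maxProb_mem_Icc ρ X) (maxProb_mem_Icc ρ Y) (maxProb_mem_Icc ρ Z)
    (maxProb_add_maxProb_le ρ X Y) (maxProb_add_maxProb_le ρ X Z) (maxProb_add_maxProb_le ρ Y Z)
    (add_le_add_right (Real.sqrt_le_sqrt hYZ) 1) (add_le_add_right (Real.sqrt_le_sqrt hXZ) 1)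
    (by linarith [half_le_sqrt_incompatibility Y Z])
  set x := √(incompatibility X Y)
  set y := √(incompatibility X Z)
  set z := √(incompatibility Y Z)
  rw [fP_one, add_sub_cancel_left, add_sub_cancel_left,
    show (1 + x + (1 + y) - (1 + z)) / 2 = 1 - (1 - x - y + z) / 2 by ring,
    show (1 + x + (1 + z) - (1 + y)) / 2 = 1 - (1 - x + y - z) / 2 by ring,
    show (1 + z + (1 + y) - (1 + x)) / 2 = 1 - (1 + x - y - z) / 2 by ring,
    fP_one_sub, fP_one_sub, fP_one_sub] at h
  linarith [le_geomCoherence_maxProb hρ X, le_geomCoherence_maxProb hρ Y,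
    le_geomCoherence_maxProb hρ Z]

end Sorted

/-! ### Sorting the incompatibilities by permuting the bases -/

-- With the vertices of a triangle indexed by `Fin 3`, its edge `{i, j}` is `{k + 1, k + 2}` for the
-- vertex `k` opposite to it.
lemma eq_add_one_add_two_of_ne {i j k : Fin 3} (hij : i ≠ j) (hik : i ≠ k) (hjk : j ≠ k) :
    (i = k + 1 ∧ j = k + 2) ∨ (i = k + 2 ∧ j = k + 1) := by
  revert i j k
  decide

lemma incompatibility_eq_of_ne (B : Fin 3 → OrthonormalBasis (Fin 2) ℂ (Hilb 2)) {i j k : Fin 3}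
    (hij : i ≠ j) (hik : i ≠ k) (hjk : j ≠ k) :
    incompatibility (B i) (B j) = incompatibility (B (k + 1)) (B (k + 2)) := by
  rcases eq_add_one_add_two_of_ne hij hik hjk with ⟨rfl, rfl⟩ | ⟨rfl, rfl⟩
  · rfl
  · exact incompatibility_comm _ _

lemma exists_perm_incompatibility_eq {X Y Z : OrthonormalBasis (Fin 2) ℂ (Hilb 2)}
    {c₁ c₂ c₃ : ℝ} (hc : incompatibilityVector X Y Z = ![c₁, c₂, c₃]) :
    c₃ ≤ c₂ ∧ c₂ ≤ c₁ ∧ ∃ e : Equiv.Perm (Fin 3),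
      incompatibility (![X, Y, Z] (e 0)) (![X, Y, Z] (e 1)) = c₁ ∧
      incompatibility (![X, Y, Z] (e 0)) (![X, Y, Z] (e 2)) = c₂ ∧
      incompatibility (![X, Y, Z] (e 1)) (![X, Y, Z] (e 2)) = c₃ := by
  set v := ![incompatibility X Y, incompatibility Y Z, incompatibility X Z]
  set s := Tuple.sort v
  have hc₁ : v (s 2) = c₁ := congrFun hc 0
  have hc₂ : v (s 1) = c₂ := congrFun hc 1
  have hc₃ : v (s 0) = c₃ := congrFun hc 2
  have hmono : Monotone (v ∘ s) := Tuple.monotone_sort v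
  have hv (k : Fin 3) : v k = incompatibility (![X, Y, Z] k) (![X, Y, Z] (k + 1)) := by
    fin_cases k
    exacts [rfl, rfl, incompatibility_comm X Z]
  -- `v (s k)` belongs to the edge `{s k, s k + 1}`, whose opposite vertex is `s k + 2`.
  set e : Equiv.Perm (Fin 3) := s.trans (Equiv.addRight 2)
  have hopp {i j k : Fin 3} (hij : i ≠ j) (hik : i ≠ k) (hjk : j ≠ k) :
      incompatibility (![X, Y, Z] (e i)) (![X, Y, Z] (e j)) = v (s k) := by
    have hk₁ : e k + 1 = s k := by
      change s k + 2 + 1 = s k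
      rw [add_assoc]
      exact add_zero _
    have hk₂ : e k + 2 = s k + 1 := by
      rw [← hk₁, add_assoc]
      rfl
    rw [incompatibility_eq_of_ne _ (e.injective.ne hij) (e.injective.ne hik)
      (e.injective.ne hjk), hv, hk₁, hk₂]
  have h₃₂ : c₃ ≤ c₂ := hc₃ ▸ hc₂ ▸ hmono (by decide : (0 : Fin 3) ≤ 1)
  have h₂₁ : c₂ ≤ c₁ := hc₂ ▸ hc₁ ▸ hmono (by decide : (1 : Fin 3) ≤ 2)
  exact ⟨h₃₂, h₂₁, e, (hopp (by decide) (by decide) (by decide)).trans hc₁,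
    (hopp (by decide) (by decide) (by decide)).trans hc₂,
    (hopp (by decide) (by decide) (by decide)).trans hc₃⟩

end GeomCoherence

open GeomCoherence in
theorem theorem3_general (ρ : Matrix (Fin 2) (Fin 2) ℂ) (hρ : IsState ρ)
    (X Y Z : OrthonormalBasis (Fin 2) ℂ (EuclideanSpace ℂ (Fin 2))) (c₁ c₂ c₃ : ℝ)
    (hc : incompatibilityVector X Y Z = ![c₁, c₂, c₃]) (f : ℝ → ℝ) (hf : f = fP (purity ρ)) :
    1 - 1 / 2 * (f (√c₁) + f (√c₁ - √c₃)) ≤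
        geomCoherence X ρ + geomCoherence Y ρ + geomCoherence Z ρ ∧
      3 / 2 - 1 / 2 * max (1 + f (√c₁) + f (√c₂))
          (f ((1 - √c₁ - √c₂ + √c₃) / 2) + f ((1 - √c₁ + √c₂ - √c₃) / 2)
            + f ((1 + √c₁ - √c₂ - √c₃) / 2)) ≤
        geomCoherence X ρ + geomCoherence Y ρ + geomCoherence Z ρ := by
  obtain ⟨h₃₂, h₂₁, e, rfl, rfl, rfl⟩ := exists_perm_incompatibility_eq hc
  have hsum : geomCoherence X ρ + geomCoherence Y ρ + geomCoherence Z ρ =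
      ∑ i, geomCoherence (![X, Y, Z] (e i)) ρ := by
    rw [Equiv.sum_comp e fun i => geomCoherence (![X, Y, Z] i) ρ, Fin.sum_univ_three]
    rfl
  rw [hf, hsum, Fin.sum_univ_three]
  exact ⟨sub_fP_le_geomCoherence_add hρ h₂₁, sub_max_fP_le_geomCoherence_add hρ h₃₂ h₂₁⟩

theorem theorem3 (ρ : Matrix (Fin 2) (Fin 2) ℂ) (hρ : GeomCoherence.IsState ρ)
    (X Y Z : OrthonormalBasis (Fin 2) ℂ (EuclideanSpace ℂ (Fin 2)))
    (c₁ c₂ c₃ : ℝ)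
    (hc : GeomCoherence.incompatibilityVector X Y Z = ![c₁, c₂, c₃])
    (f : ℝ → ℝ) (hf : f = GeomCoherence.fP (GeomCoherence.purity ρ)) :
    (1 + √c₃ < √c₁ + √c₂ →
      GeomCoherence.geomCoherence X ρ + GeomCoherence.geomCoherence Y ρ
          + GeomCoherence.geomCoherence Z ρ
        ≥ 1 - 1 / 2 * (f (√c₁) + f (√c₁ - √c₃))) ∧
    (1 + √c₃ ≥ √c₁ + √c₂ →
      GeomCoherence.geomCoherence X ρ + GeomCoherence.geomCoherence Y ρ
          + GeomCoherence.geomCoherence Z ρ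
        ≥ 3 / 2 - 1 / 2 * max (1 + f (√c₁) + f (√c₂))
            (f ((1 - √c₁ - √c₂ + √c₃) / 2) + f ((1 - √c₁ + √c₂ - √c₃) / 2)
              + f ((1 + √c₁ - √c₂ - √c₃) / 2))) := by
  have h := theorem3_general ρ hρ X Y Z c₁ c₂ c₃ hc f hf
  exact ⟨fun _ => h.1, fun _ => h.2⟩
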